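/- Let $G$ be a locally compact (Hausdorff), second countable, unimodular group with a fixed Haar measure $dx$, and let $K$ be a compact subgroup of $G$ with normalized Haar measure $dk$. Let $\mu$ be the measure on $G/K$ given by $\int_G f(x)\,dx=\int_{G/K}\int_K f(xk)\,dk\,d\mu(xK)$. A compact set $E\subseteq G/K$ has the \emph{Pompeiu property} if $f=0$ is the only continuous function $f\colon G/K\to\mathbb{C}$ with $\int_{gE}f\,d\mu=0$ for all $g\in G$. Let $\mathcal{C}(G)$ be the space of continuous complex-valued functions on $G$, and let $\mathcal{M}_c(G)$ be the space of compactly supported complex Borel measures on $G$, with the weak* topology given by the pairing $\langle f,\nu\rangle=\int_G f\,d\nu$ with $f\in\mathcal{C}(G)$, and with convolution $\langle f,\nu*\rho\rangle=\int_G\int_G f(xy)\,d\nu(x)\,d\rho(y)$ as multiplication. Let $\mathcal{M}_c(G//K)$ be the topological algebra of $K$-biinvariant measures, that is, of those $\nu\in\mathcal{M}_c(G)$ with $\langle f,\nu\rangle=\langle f^{\#},\nu\rangle$ for all $f\in\mathcal{C}(G)$, where $f^{\#}(x)=\int_K\int_K f(lxk)\,dl\,dk$. For $A\subseteq G/K$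 put $\widetilde{A}=\{g\in G\mid gK\in A\}$. For a compact set $E\subseteq G/K$ let $\check{\chi}_{\widetilde{E}}(x)=\chi_{\widetilde{E}}(x^{-1})$, regarded as the measure $\check{\chi}_{\widetilde{E}}(x)\,dx$, and for $g\in G$ let $\chi_{\widetilde{gK}}$ denote the measure $f\mapsto\int_K f(gk)\,dk$. Let $T$ be a left transversal of $K$ in $G$, that is, a set of representatives for the left cosets of $K$. Theorem. Let $E$ be a compact subset of $G/K$, and let $I$ be the closed right ideal of $\mathcal{M}_c(G//K)$ generated by $\{\check{\chi}_{\widetilde{E}}*\chi_{\widetilde{gK}}\mid g\in T\}$, that is, the smallest weak*-closed right ideal that contains this set. Then $E$ has the Pompeiu property if and only if $I=\mathcal{M}_c(G//K)$. -/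

import Mathlib

open MeasureTheory
open scoped Pointwise Topology

set_option linter.unusedSectionVars false

noncomputable section

namespace Pompeiu

section ComplexMeasures

variable {X : Type*} [MeasurableSpace X]

/-- A complex measure has finite total variation. -/
instance isFiniteMeasure_variation (μ : ComplexMeasure X) : IsFiniteMeasure μ.variation := by
  have h : μ.variation ≤ (ComplexMeasure.re μ).totalVariation +
      (ComplexMeasure.im μ).totalVariation := by
    rw [SignedMeasure.totalVariation_eq_variation, SignedMeasure.totalVariation_eq_variation]
    refine VectorMeasure.variation_le_of_forall_enorm_le fun s _ => ?_
    have h1 : ‖μ s‖ₑ ≤ ‖(μ s).re‖ₑ + ‖(μ s).im‖ₑ := by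
      rw [← ofReal_norm, ← ofReal_norm, ← ofReal_norm,
        ← ENNReal.ofReal_add (norm_nonneg _) (norm_nonneg _)]
      exact ENNReal.ofReal_le_ofReal (Complex.norm_le_abs_re_add_abs_im _)
    refine h1.trans ?_
    rw [Measure.add_apply]
    exact add_le_add (VectorMeasure.enorm_measure_le_variation (ComplexMeasure.re μ) s)
      (VectorMeasure.enorm_measure_le_variation (ComplexMeasure.im μ) s)
  exact isFiniteMeasure_of_le _ h

/-- The integral `⟨f, μ⟩ = ∫ f dμ` of a complex function against a complex measure. -/
def pairing (f : X → ℂ) (μ : ComplexMeasure X) : ℂ :=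
  μ.integral f (ContinuousLinearMap.mul ℝ ℂ)

theorem pairing_zero (f : X → ℂ) : pairing f (0 : ComplexMeasure X) = 0 :=
  VectorMeasure.integral_zero_vectorMeasure

theorem pairing_add {f : X → ℂ} {μ ν : ComplexMeasure X} (hμ : μ.Integrable f)
    (hν : ν.Integrable f) : pairing f (μ + ν) = pairing f μ + pairing f ν :=
  VectorMeasure.integral_add_vectorMeasure hμ hν

theorem pairing_smul {f : X → ℂ} {μ : ComplexMeasure X} (hμ : μ.Integrable f) (c : ℂ) :
    pairing f (c • μ) = c * pairing f μ := by
  have hle : (c • μ).variation ≤ (‖c‖₊ : ENNReal) • μ.variation := by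
    rw [VectorMeasure.variation_smul]; rfl
  let L : ℂ →L[ℝ] ℂ := ContinuousLinearMap.mul ℝ ℂ c
  let B : ℂ →L[ℝ] ℂ →L[ℝ] ℂ :=
    (ContinuousLinearMap.compL ℝ ℂ ℂ ℂ L) ∘L (ContinuousLinearMap.mul ℝ ℂ)
  have hT : ((c • μ).transpose (ContinuousLinearMap.mul ℝ ℂ) : Set X → ℂ →L[ℝ] ℂ) =
      μ.transpose B := by
    funext s
    ext x
    change x * (c * μ s) = c * (x * μ s)
    ring
  have h1 : c * pairing f μ = μ.integral f B :=
    VectorMeasure.continuousLinearMap_apply_integral (C := L) hμ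
  have hd := dominatedFinMeasAdditive_cbmApplyMeasure (c • μ) (ContinuousLinearMap.mul ℝ ℂ)
  have hd' := hd
  rw [hT] at hd'
  have h2 : μ.integral f B = setToFun (c • μ).variation (μ.transpose B) hd' f :=
    setToFun_congr_measure_of_integrable _ (by simp) hle _ hd' f hμ
  rw [h1, h2]
  exact setToFun_congr_left hd hd' hT f

end ComplexMeasures

section Group

variable {G : Type*} [Group G] [TopologicalSpace G] [IsTopologicalGroup G] [T2Space G]
  [SecondCountableTopology G] [MeasurableSpace G] [BorelSpace G]

/-- `C` supports the complex measure `μ`. -/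
def SupportedOn (μ : ComplexMeasure G) (C : Set G) : Prop :=
  ∀ A : Set G, Disjoint A C → μ A = 0

theorem integrable_of_supportedOn {μ : ComplexMeasure G} {C : Set G} (hC : IsCompact C)
    (h : SupportedOn μ C) {f : G → ℂ} (hf : Continuous f) : μ.Integrable f := by
  have h0 : μ.variation Cᶜ = 0 := by
    rw [VectorMeasure.variation_apply_eq_zero hC.measurableSet.compl]
    intro A hA _
    exact h A (Set.disjoint_left.2 fun x hx hx' => hA hx hx')
  have h1 : IntegrableOn f C μ.variation := hf.continuousOn.integrableOn_compact hC
  have h2 : IntegrableOn f Cᶜ μ.variation := by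
    rw [IntegrableOn, Measure.restrict_eq_zero.2 h0]
    exact integrable_zero_measure
  have := h1.union h2
  rwa [Set.union_compl_self, integrableOn_univ] at this

variable (G) in
/-- `M_c(G)`: the complex Borel measures on `G` with compact support. -/
def compactMeasures : Submodule ℂ (ComplexMeasure G) where
  carrier := {μ | ∃ C : Set G, IsCompact C ∧ SupportedOn μ C}
  zero_mem' := ⟨∅, isCompact_empty, fun _ _ => rfl⟩
  add_mem' := by
    rintro μ ν ⟨C, hC, h⟩ ⟨D, hD, h'⟩
    refine ⟨C ∪ D, hC.union hD, fun A hA => ?_⟩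
    rw [Set.disjoint_union_right] at hA
    rw [_root_.add_apply, h A hA.1, h' A hA.2, add_zero]
  smul_mem' := by
    rintro c μ ⟨C, hC, h⟩
    refine ⟨C, hC, fun A hA => ?_⟩
    rw [_root_.smul_apply, h A hA, smul_zero]

theorem integrable_of_mem {μ : ComplexMeasure G} (hμ : μ ∈ compactMeasures G) {f : G → ℂ}
    (hf : Continuous f) : μ.Integrable f := by
  obtain ⟨C, hC, h⟩ := hμ
  exact integrable_of_supportedOn hC h hf

/-- Convolution: the image of `μ ⊗ ν` under the multiplication of `G`. -/
def conv (μ ν : ComplexMeasure G) : ComplexMeasure G :=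
  (μ.prod ν (ContinuousLinearMap.mul ℝ ℂ)).map fun p : G × G => p.1 * p.2

theorem conv_mem {μ ν : ComplexMeasure G} (hμ : μ ∈ compactMeasures G)
    (hν : ν ∈ compactMeasures G) : conv μ ν ∈ compactMeasures G := by
  obtain ⟨C, hC, h⟩ := hμ
  obtain ⟨D, hD, h'⟩ := hν
  refine ⟨C * D, hC.mul hD, fun A hA => ?_⟩
  by_cases hm : MeasurableSet A
  swap
  · exact VectorMeasure.not_measurable _ hm
  have hmul : Measurable fun p : G × G => p.1 * p.2 := measurable_mul
  rw [conv, VectorMeasure.map_apply _ hmul hm, VectorMeasure.prod_apply_eq_integral (hmul hm)]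
  refine VectorMeasure.integral_eq_zero_of_ae ?_
  have h0 : μ.variation Cᶜ = 0 := by
    rw [VectorMeasure.variation_apply_eq_zero hC.measurableSet.compl]
    intro A hA _
    exact h A (Set.disjoint_left.2 fun x hx hx' => hA hx hx')
  filter_upwards [mem_ae_iff.2 (by simpa using h0 : μ.variation Cᶜ = 0)] with x hx
  refine h' _ (Set.disjoint_left.2 fun y hy hy' => ?_)
  exact Set.disjoint_left.1 hA hy (Set.mul_mem_mul hx hy')

/-- Multiplication in `M_c(G)` is convolution. -/
instance : Mul (compactMeasures G) := ⟨fun μ ν => ⟨conv μ.1 ν.1, conv_mem μ.2 ν.2⟩⟩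

/-- The weak* topology of `M_c(G)` as the dual of `C(G)`. -/
instance : TopologicalSpace (compactMeasures G) :=
  TopologicalSpace.induced (fun μ (f : C(G, ℂ)) => pairing f μ.1) inferInstance

variable [LocallyCompactSpace G] (K : Subgroup G) [CompactSpace K]

/-- The normalized Haar measure of the compact group `K`. -/
def haarK : Measure K := Measure.haarMeasure ⊤

instance : IsFiniteMeasure (haarK K) :=
  ⟨by rw [haarK, ← TopologicalSpace.PositiveCompacts.coe_top, Measure.haarMeasure_self]; simp⟩

/-- The projection `f^#(x) = ∫_K ∫_K f(l x k) dl dk` of `C(G)` onto `C(G//K)`. -/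
def sharp (f : C(G, ℂ)) : C(G, ℂ) where
  toFun x := ∫ k : K, ∫ l : K, f (l * x * k) ∂haarK K ∂haarK K
  continuous_toFun := by
    have : SecondCountableTopology K :=
      inferInstanceAs (SecondCountableTopology (K : Set G))
    have h1 : Continuous fun p : G × K => ∫ l : K, f (l * p.1 * p.2) ∂haarK K := by
      have := continuous_parametric_integral_of_continuous (μ := haarK K) (s := Set.univ)
        (f := fun (p : G × K) (l : K) => f (l * p.1 * p.2)) (by
          simp only [Function.uncurry_def]; fun_prop) isCompact_univ
      simpa using this
    have := continuous_parametric_integral_of_continuous (μ := haarK K) (s := Set.univ)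
      (f := fun (x : G) (k : K) => ∫ l : K, f (l * x * k) ∂haarK K) h1 isCompact_univ
    simpa using this

/-- `M_c(G//K)`: the `K`-biinvariant measures in `M_c(G)`, those with `⟨f, μ⟩ = ⟨f^#, μ⟩` for all
continuous `f`. -/
def biinvariant : Submodule ℂ (compactMeasures G) where
  carrier := {μ | ∀ f : C(G, ℂ), pairing f μ.1 = pairing (sharp K f) μ.1}
  zero_mem' f := by
    rw [Submodule.coe_zero, pairing_zero, pairing_zero]
  add_mem' := by
    intro μ ν h h' f
    rw [Submodule.coe_add, pairing_add (integrable_of_mem μ.2 f.continuous)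
      (integrable_of_mem ν.2 f.continuous), pairing_add
      (integrable_of_mem μ.2 (sharp K f).continuous)
      (integrable_of_mem ν.2 (sharp K f).continuous), h f, h' f]
  smul_mem' := by
    intro c μ h f
    rw [Submodule.coe_smul, pairing_smul (integrable_of_mem μ.2 f.continuous),
      pairing_smul (integrable_of_mem μ.2 (sharp K f).continuous), h f]

/-- `J` is a weak*-closed right ideal of the topological algebra `M_c(G//K)`. -/
structure IsClosedRightIdeal (J : Submodule ℂ (compactMeasures G)) : Prop where
  le_biinvariant : J ≤ biinvariant K
  mul_mem : ∀ μ ∈ J, ∀ ν ∈ biinvariant K, μ * ν ∈ J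
  isClosed : IsClosed {μ : biinvariant K | (μ : compactMeasures G) ∈ J}

/-- The right ideal of the topological algebra `M_c(G//K)` generated by `S`: the smallest
weak*-closed right ideal that contains `S`. -/
def closedRightIdealSpan (S : Set (compactMeasures G)) : Submodule ℂ (compactMeasures G) :=
  sInf {J | IsClosedRightIdeal K J ∧ S ⊆ J}

/-- The lift `{g ∈ G | gK ∈ E}` of `E ⊆ G/K` to `G`. -/
def lift (E : Set (G ⧸ K)) : Set G := {g : G | (g : G ⧸ K) ∈ E}

/-- The function `x ↦ χ(x⁻¹)` on `G`, where `χ` is the characteristic function of the lift of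
`E`. -/
def checkChar (E : Set (G ⧸ K)) : G → ℂ :=
  fun x => (lift K E).indicator (fun _ => 1) x⁻¹

theorem exists_compact_of_lift {E : Set (G ⧸ K)} (hE : IsCompact E) :
    ∃ C : Set G, IsCompact C ∧ (lift K E)⁻¹ ⊆ C := by
  obtain ⟨t, ht⟩ := hE.elim_finite_subcover
    (fun x : G => ((↑) : G → G ⧸ K) '' interior (exists_compact_mem_nhds x).choose)
    (fun x => QuotientGroup.isOpenMap_coe _ isOpen_interior) (by
      intro q _
      obtain ⟨x, rfl⟩ := QuotientGroup.mk_surjective q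
      exact Set.mem_iUnion.2 ⟨x, x, mem_interior_iff_mem_nhds.2
        (exists_compact_mem_nhds x).choose_spec.2, rfl⟩)
  refine ⟨((⋃ x ∈ t, (exists_compact_mem_nhds x).choose) * (K : Set G))⁻¹,
    ((t.isCompact_biUnion fun x _ => (exists_compact_mem_nhds x).choose_spec.1).mul
      (isCompact_iff_compactSpace.2 ‹_›)).inv, Set.inv_subset_inv.2 fun g hg => ?_⟩
  obtain ⟨x, hx, y, hy, hyg⟩ := Set.mem_iUnion₂.1 (ht hg)
  exact Set.mem_mul.2 ⟨y, Set.mem_biUnion hx (interior_subset hy), y⁻¹ * g,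
    QuotientGroup.eq.1 hyg, mul_inv_cancel_left y g⟩

variable (haar : Measure G)

/-- The measure on `G/K` belonging to the Haar measure of `G` and the normalized Haar measure of
`K`; it satisfies Weil's formula, see `integral_quotientMeasure`. -/
def quotientMeasure : Measure (G ⧸ K) := haar.map ((↑) : G → G ⧸ K)

/-- Weil's formula `∫_{G/K} ∫_K f(xk) dk dμ(xK) = ∫_G f(x) dx`. -/
theorem integral_quotientMeasure [haar.IsHaarMeasure] [haar.IsMulRightInvariant]
    (f : C(G, ℂ)) (hf : HasCompactSupport f) (F : G ⧸ K → ℂ)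
    (hF : ∀ x : G, F (x : G ⧸ K) = ∫ k : K, f (x * k) ∂haarK K) :
    ∫ q, F q ∂quotientMeasure K haar = ∫ x, f x ∂haar := by
  have hK : IsCompact (K : Set G) := isCompact_iff_compactSpace.2 ‹_›
  have hu : haarK K Set.univ = 1 := Measure.haarMeasure_self
  have hFm : Measurable F := by
    refine QuotientGroup.measurable_from_quotient.2 ?_
    have h := continuous_parametric_integral_of_continuous (μ := haarK K) (s := Set.univ)
      (f := fun (x : G) (k : K) => f (x * k)) (by
        simp only [Function.uncurry_def]; fun_prop) isCompact_univ
    simp only [Measure.restrict_univ] at h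
    exact (h.congr fun x => (hF x).symm).measurable
  rw [quotientMeasure, integral_map QuotientGroup.measurable_coe.aemeasurable
    hFm.aestronglyMeasurable]
  simp only [hF]
  rw [integral_integral_swap_of_hasCompactSupport (f := fun (x : G) (k : K) => f (x * k))
    (by simp only [Function.uncurry_def]; fun_prop)]
  · simp only [integral_mul_right_eq_self (μ := haar) f]
    simp [Measure.real, hu]
  · refine HasCompactSupport.intro ((hf.isCompact.mul hK).prod isCompact_univ)
      fun p hp => image_eq_zero_of_notMem_tsupport (f := f) fun h => hp ⟨?_, trivial⟩
    exact Set.mem_mul.2 ⟨p.1 * p.2, h, (p.2 : G)⁻¹, K.inv_mem p.2.2, mul_inv_cancel_right _ _⟩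

/-- `E` has the Pompeiu property: `f = 0` is the only continuous function on `G/K` whose integrals
over all translates `gE` vanish. -/
def HasPompeiuProperty (E : Set (G ⧸ K)) : Prop :=
  ∀ f : C(G ⧸ K, ℂ), (∀ g : G, ∫ q in g • E, f q ∂quotientMeasure K haar = 0) → f = 0

/-- The function `checkChar K E` regarded as the element `checkChar K E dx` of `M_c(G)`. -/
def checkMeasure (E : Set (G ⧸ K)) (hE : IsCompact E) : compactMeasures G :=
  ⟨haar.withDensityᵥ (checkChar K E), by
    obtain ⟨C, hC, hEC⟩ := exists_compact_of_lift K hE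
    refine ⟨C, hC, fun A hA => ?_⟩
    by_cases hm : MeasurableSet A
    swap
    · exact VectorMeasure.not_measurable _ hm
    by_cases hi : Integrable (checkChar K E) haar
    · rw [withDensityᵥ_apply hi hm]
      refine setIntegral_eq_zero_of_forall_eq_zero fun x hx => ?_
      have hx' : x⁻¹ ∉ lift K E := fun hx' => Set.disjoint_left.1 hA hx (hEC hx')
      exact Set.indicator_of_notMem hx' _
    · rw [Measure.withDensityᵥ, dif_neg hi]; rfl⟩

/-- The characteristic function of the coset `gK`, regarded as the element `f ↦ ∫_K f(gk) dk` of
`M_c(G)`: the image of the normalized Haar measure of `K` under `k ↦ gk`. -/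
def cosetMeasure (g : G) : compactMeasures G :=
  ⟨((haarK K).withDensityᵥ fun _ => (1 : ℂ)).map fun k : K => g * k, by
    refine ⟨Set.range fun k : K => g * k, isCompact_range (by fun_prop), fun A hA => ?_⟩
    by_cases hm : MeasurableSet A
    swap
    · exact VectorMeasure.not_measurable _ hm
    rw [VectorMeasure.map_apply _ (by fun_prop) hm]
    have : (fun k : K => g * (k : G)) ⁻¹' A = ∅ := by
      ext k
      simpa using fun hk => Set.disjoint_left.1 hA hk ⟨k, rfl⟩
    rw [this, VectorMeasure.empty]⟩

end Group

end Pompeiu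

end

/-!
Functions on `G/K` and left `K`-invariant functions on `G` correspond to each other by
`f ↦ φ`, `φ(x) = f(x⁻¹K)`. As `G` is unimodular, its Haar measure is invariant under inversion, and
the integral of `f` over `gE` becomes the pairing of the right translate `φ(· g⁻¹)` with the measure
`checkMeasure` of `E` (`setIntegral_smul_eq_pairing`). Hence `E` fails to have the Pompeiu property
iff some nonzero left `K`-invariant continuous `φ` has all its right translates annihilated by
`checkMeasure`.

If there is such a `φ`, the biinvariant measures that annihilate all right translates of `φ` form a
weak*-closed right ideal (`isClosedRightIdeal_annihilator`) which contains the generators. The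
normalized Haar measure of `K` is biinvariant, and pairing it with the right translates of `φ`
recovers the values of `φ`; so it does not lie in this ideal, and the generated ideal is proper.

Conversely, let `J` be a weak*-closed right ideal that contains the generators and misses a
biinvariant measure `μ₀`. By Hahn-Banach (`exists_pairing_ne_zero`) some `f ∈ C(G)` annihilates `J`
but not `μ₀`, and so does its biinvariant projection `φ = f^#`. Pairing `φ` with the generators
shows that `checkMeasure` annihilates the translates of `φ` by `T`, hence, as `φ` is right
`K`-invariant, all its right translates. The Pompeiu property gives `φ = 0`, a contradiction.

Two facts about complex measures are used throughout. Every complex measure is a density times its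
total variation (`withDensity_rnDeriv_variation`), so that pairings are Bochner integrals
(`pairing_withDensity`) and Fubini's theorem applies; this yields the formula for pairings with a
convolution (`pairing_conv`). And a measure is `K`-biinvariant iff it is invariant under left and
right translations by `K` (`mem_biinvariant_iff`).
-/

noncomputable section

namespace Pompeiu

/-! ### Complex measures as densities -/

section Density

variable {X Y : Type*} [MeasurableSpace X] [MeasurableSpace Y]

theorem pairing_withDensity {m : Measure X} {h : X → ℂ} (hh : Integrable h m) {f : X → ℂ}
    (hf : (m.withDensityᵥ h).Integrable f) :
    pairing f (m.withDensityᵥ h) = ∫ x, f x * h x ∂m := by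
  have hvar := Measure.variation_withDensityᵥ hh
  have hlt : ∀ᵐ x ∂m, ‖h x‖ₑ < ⊤ := Filter.Eventually.of_forall fun x => by simp
  have hmeas : AEMeasurable (fun x => ‖h x‖ₑ) m := hh.1.enorm
  have hsign : AEStronglyMeasurable (fun x => (‖h x‖⁻¹ : ℝ) • h x) m :=
    hh.1.norm.inv₀.smul hh.1
  have hsignv : AEStronglyMeasurable (fun x => (‖h x‖⁻¹ : ℝ) • h x)
      (m.withDensityᵥ h).variation := by
    rw [hvar]; exact hsign.mono_ac (withDensity_absolutelyContinuous _ _)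
  have hle : ∀ x, ‖(‖h x‖⁻¹ : ℝ) • h x‖ ≤ 1 := fun x => by
    simp [inv_mul_le_one]
  -- Both sides have to be continuous on `L¹` of the total variation `‖h‖ dm`, so the right-hand
  -- side is rewritten as an integral of `f` times the bounded function `h / ‖h‖` against it.
  have key : ∀ f : X → ℂ, ∫ x, f x * h x ∂m =
      ∫ x, f x * ((‖h x‖⁻¹ : ℝ) • h x) ∂(m.withDensityᵥ h).variation := by
    intro f
    rw [hvar, integral_withDensity_eq_integral_toReal_smul₀ hmeas hlt]
    refine integral_congr_ae (Filter.Eventually.of_forall fun x => ?_)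
    rcases eq_or_ne (h x) 0 with hx | hx
    · simp [hx]
    · have : (‖h x‖ : ℂ) ≠ 0 := by simpa using hx
      simp only [toReal_enorm, Complex.real_smul, Complex.ofReal_inv]
      field_simp
  rw [key]
  have hint : ∀ {f : X → ℂ}, Integrable f (m.withDensityᵥ h).variation →
      Integrable (fun x => f x * ((‖h x‖⁻¹ : ℝ) • h x)) (m.withDensityᵥ h).variation :=
    fun hf => hf.mul_bdd hsignv (Filter.Eventually.of_forall hle)
  refine Integrable.induction (P := fun f => pairing f (m.withDensityᵥ h) =
    ∫ x, f x * ((‖h x‖⁻¹ : ℝ) • h x) ∂(m.withDensityᵥ h).variation) ?_ ?_ ?_ ?_ hf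
  · intro c s hs hms
    rw [← key, pairing, VectorMeasure.integral_eq_setToFun, setToFun_indicator_const _ hs hms.ne]
    change c * (m.withDensityᵥ h) s = _
    rw [withDensityᵥ_apply hh hs, ← integral_const_mul, ← integral_indicator hs]
    refine integral_congr_ae (Filter.Eventually.of_forall fun x => ?_)
    by_cases hx : x ∈ s <;> simp [hx]
  · intro f g _ hf hg h1 h2
    calc pairing (f + g) (m.withDensityᵥ h)
        = pairing f (m.withDensityᵥ h) + pairing g (m.withDensityᵥ h) :=
          VectorMeasure.integral_add hf hg
      _ = _ := by
          rw [h1, h2, ← integral_add (hint hf) (hint hg)]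
          simp only [Pi.add_apply, add_mul]
  · refine isClosed_eq (continuous_setToFun _) ?_
    refine LipschitzWith.continuous (K := 1) (LipschitzWith.of_dist_le_mul fun f g => ?_)
    rw [dist_eq_norm, ← integral_sub (hint (L1.integrable_coeFn f)) (hint (L1.integrable_coeFn g)),
      NNReal.coe_one, one_mul, L1.dist_eq_integral_dist]
    simp only [dist_eq_norm]
    refine norm_integral_le_of_norm_le ((L1.integrable_coeFn f).sub (L1.integrable_coeFn g)).norm
      (Filter.Eventually.of_forall fun x => ?_)
    rw [← sub_mul, norm_mul]
    exact mul_le_of_le_one_right (norm_nonneg _) (hle x)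
  · intro f g hfg _ h1
    calc pairing g (m.withDensityᵥ h) = pairing f (m.withDensityᵥ h) :=
          (VectorMeasure.integral_congr_ae hfg).symm
      _ = _ := h1
      _ = _ := integral_congr_ae (hfg.mono fun x hx => by simp only [hx])

/-- The Radon-Nikodym theorem for a complex measure and its total variation. -/
theorem withDensity_rnDeriv_variation (μ : ComplexMeasure X) :
    μ.variation.withDensityᵥ (μ.rnDeriv μ.variation) = μ := by
  have hac : ∀ ν : SignedMeasure X, (∀ s, μ s = 0 → ν s = 0) →
      ν ≪ᵥ μ.variation.toENNRealVectorMeasure := by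
    intro ν hν
    refine VectorMeasure.AbsolutelyContinuous.mk fun s hs h0 => hν s ?_
    rw [Measure.toENNRealVectorMeasure_apply_measurable hs] at h0
    exact VectorMeasure.variation_apply_eq_zero hs |>.1 h0 s subset_rfl hs
  have hre := SignedMeasure.withDensityᵥ_rnDeriv_eq (ComplexMeasure.re μ) μ.variation
    (hac _ fun s h => congrArg Complex.re h)
  have him := SignedMeasure.withDensityᵥ_rnDeriv_eq (ComplexMeasure.im μ) μ.variation
    (hac _ fun s h => congrArg Complex.im h)
  have hi := μ.integrable_rnDeriv μ.variation
  ext s hs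
  rw [withDensityᵥ_apply hi hs]
  apply Complex.ext
  · rw [← RCLike.re_eq_complex_re, ← integral_re hi.integrableOn, RCLike.re_eq_complex_re]
    have := congrArg (fun ν => ν s) hre
    rw [withDensityᵥ_apply (SignedMeasure.integrable_rnDeriv _ _) hs] at this
    exact this
  · rw [← RCLike.im_eq_complex_im, ← integral_im hi.integrableOn, RCLike.im_eq_complex_im]
    have := congrArg (fun ν => ν s) him
    rw [withDensityᵥ_apply (SignedMeasure.integrable_rnDeriv _ _) hs] at this
    exact this

theorem prod_withDensity {m : Measure X} {n : Measure Y} [SFinite m] [SFinite n]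
    {h : X → ℂ} {k : Y → ℂ} (hh : Integrable h m) (hk : Integrable k n) :
    (m.withDensityᵥ h).prod (n.withDensityᵥ k) (ContinuousLinearMap.mul ℝ ℂ) =
      (m.prod n).withDensityᵥ fun p => h p.1 * k p.2 := by
  refine VectorMeasure.prod_eq_of_forall_apply_prod fun s t hs ht => ?_
  rw [withDensityᵥ_apply (hh.mul_prod hk) (hs.prod ht), withDensityᵥ_apply hh hs,
    withDensityᵥ_apply hk ht, setIntegral_prod_mul]
  rfl

end Density

/-! ### Continuous functions and compactly supported densities -/

section Fubini

variable {X Y : Type*} [MeasurableSpace X] [MeasurableSpace Y]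
  [TopologicalSpace X] [TopologicalSpace Y] [OpensMeasurableSpace X] [OpensMeasurableSpace Y]

theorem integrable_continuous_mul {m : Measure X} {C : Set X} (hC : IsCompact C)
    (hmC : m Cᶜ = 0) {h F : X → ℂ} (hh : Integrable h m) (hF : Continuous F) :
    Integrable (fun x => F x * h x) m := by
  obtain ⟨M, hM⟩ := hC.exists_bound_of_continuousOn hF.continuousOn
  refine hh.bdd_mul (c := M) hF.aestronglyMeasurable ?_
  filter_upwards [mem_ae_iff.2 hmC] with x hx using hM x hx

theorem integrable_continuous_mul_prod [SecondCountableTopology X]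
    {m : Measure X} {n : Measure Y} [SFinite m] [SFinite n]
    {C : Set X} {D : Set Y} (hC : IsCompact C) (hD : IsCompact D) (hmC : m Cᶜ = 0)
    (hnD : n Dᶜ = 0) {h : X → ℂ} {k : Y → ℂ} (hh : Integrable h m) (hk : Integrable k n)
    {F : X × Y → ℂ} (hF : Continuous F) :
    Integrable (fun p => F p * (h p.1 * k p.2)) (m.prod n) := by
  refine integrable_continuous_mul (hC.prod hD) ?_ (hh.mul_prod hk) hF
  rw [Set.compl_prod_eq_union]
  exact measure_union_null (by simp [Measure.prod_prod, hmC]) (by simp [Measure.prod_prod, hnD])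

theorem continuous_integral_mul_density [LocallyCompactSpace X] [FirstCountableTopology X]
    {n : Measure Y} {D : Set Y} (hD : IsCompact D) (hnD : n Dᶜ = 0) {k : Y → ℂ}
    (hk : Integrable k n) {F : X × Y → ℂ} (hF : Continuous F) :
    Continuous fun x => ∫ y, F (x, y) * k y ∂n := by
  refine continuous_iff_continuousAt.2 fun x₀ => ?_
  obtain ⟨U, hU, hxU⟩ := exists_compact_mem_nhds x₀
  obtain ⟨M, hM⟩ := (hU.prod hD).exists_bound_of_continuousOn hF.continuousOn
  refine continuousAt_of_dominated (bound := fun y => M * ‖k y‖) ?_ ?_ (hk.norm.const_mul M) ?_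
  · exact Filter.Eventually.of_forall fun x =>
      (Continuous.aestronglyMeasurable (by fun_prop)).mul hk.1
  · filter_upwards [hxU] with x hx
    filter_upwards [mem_ae_iff.2 hnD] with y hy
    rw [norm_mul]
    exact mul_le_mul_of_nonneg_right (hM (x, y) ⟨hx, hy⟩) (norm_nonneg _)
  · exact Filter.Eventually.of_forall fun y => Continuous.continuousAt (by fun_prop)

theorem integrable_variation_withDensity {m : Measure X} {h f : X → ℂ} (hh : Integrable h m)
    (hf : Integrable (fun x => f x * h x) m) (hfc : Continuous f) :
    (m.withDensityᵥ h).Integrable f := by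
  rw [VectorMeasure.Integrable, Measure.variation_withDensityᵥ hh,
    integrable_withDensity_iff_integrable_smul₀' hh.1.enorm
      (Filter.Eventually.of_forall fun x => by simp)]
  refine hf.mono (hh.1.enorm.ennreal_toReal.aestronglyMeasurable.smul hfc.aestronglyMeasurable)
    (Filter.Eventually.of_forall fun x => ?_)
  simp [mul_comm]

end Fubini

/-! ### Fubini's theorem and convolution -/

section Group

variable {G : Type*} [Group G] [TopologicalSpace G] [IsTopologicalGroup G] [T2Space G]
  [SecondCountableTopology G] [MeasurableSpace G] [BorelSpace G]

/-- A complex measure with compact support is a density times a finite positive measure that is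
carried by a compact set. -/
theorem exists_density {μ : ComplexMeasure G} (hμ : μ ∈ compactMeasures G) :
    ∃ (m : Measure G) (h : G → ℂ) (C : Set G), IsFiniteMeasure m ∧ Integrable h m ∧ IsCompact C ∧
      m Cᶜ = 0 ∧ μ = m.withDensityᵥ h := by
  obtain ⟨C, hC, h⟩ := hμ
  refine ⟨μ.variation, μ.rnDeriv μ.variation, C, inferInstance, μ.integrable_rnDeriv _, hC, ?_,
    (withDensity_rnDeriv_variation μ).symm⟩
  rw [VectorMeasure.variation_apply_eq_zero hC.measurableSet.compl]
  intro A hA _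
  exact h A (Set.disjoint_left.2 fun x hx hx' => hA hx hx')

theorem continuous_pairing {Z : Type*} [TopologicalSpace Z] [LocallyCompactSpace Z]
    [FirstCountableTopology Z] {ν : ComplexMeasure G} (hν : ν ∈ compactMeasures G)
    {F : Z × G → ℂ} (hF : Continuous F) : Continuous fun z => pairing (fun y => F (z, y)) ν := by
  have hi : ∀ z, ν.Integrable fun y => F (z, y) := fun z => integrable_of_mem hν (by fun_prop)
  obtain ⟨n, k, D, _, hk, hD, hnD, rfl⟩ := exists_density hν
  simp only [fun z => pairing_withDensity hk (hi z)]
  let _ : MeasurableSpace Z := borel Z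
  have : BorelSpace Z := ⟨rfl⟩
  exact continuous_integral_mul_density hD hnD hk hF

/-- Fubini's theorem for the pairing and a finite positive measure on a compact space. -/
theorem integral_pairing {Z : Type*} [TopologicalSpace Z] [CompactSpace Z]
    [MeasurableSpace Z] [OpensMeasurableSpace Z] [SecondCountableTopology Z] {m : Measure Z}
    [IsFiniteMeasure m] {ν : ComplexMeasure G} (hν : ν ∈ compactMeasures G)
    {F : Z × G → ℂ} (hF : Continuous F) (hF' : Continuous fun y => ∫ z, F (z, y) ∂m) :
    ∫ z, pairing (fun y => F (z, y)) ν ∂m = pairing (fun y => ∫ z, F (z, y) ∂m) ν := by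
  have hi : ∀ z, ν.Integrable fun y => F (z, y) := fun z => integrable_of_mem hν (by fun_prop)
  have hi' := integrable_of_mem hν hF'
  obtain ⟨n, k, D, _, hk, hD, hnD, rfl⟩ := exists_density hν
  simp only [fun z => pairing_withDensity hk (hi z), pairing_withDensity hk hi']
  have := integrable_continuous_mul_prod (m := m) isCompact_univ hD (by simp) hnD
    (integrable_const 1) hk hF
  simp only [one_mul] at this
  rw [integral_integral_swap (f := fun z y => F (z, y) * k y) this]
  simp only [integral_mul_const]

variable [LocallyCompactSpace G]

/-- The pairing with a convolution as an iterated pairing, in both orders. -/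
theorem pairing_conv {μ ν : ComplexMeasure G} (hμ : μ ∈ compactMeasures G)
    (hν : ν ∈ compactMeasures G) {f : G → ℂ} (hf : Continuous f) :
    pairing f (conv μ ν) = pairing (fun x => pairing (fun y => f (x * y)) ν) μ ∧
    pairing f (conv μ ν) = pairing (fun y => pairing (fun x => f (x * y)) μ) ν := by
  have hiν : ∀ x, ν.Integrable fun y => f (x * y) := fun x => integrable_of_mem hν (by fun_prop)
  have hiμ : ∀ y, μ.Integrable fun x => f (x * y) := fun x => integrable_of_mem hμ (by fun_prop)
  have hiν' := integrable_of_mem hμ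
    (continuous_pairing hν (F := fun p : G × G => f (p.1 * p.2)) (by fun_prop))
  have hiμ' := integrable_of_mem hν
    (continuous_pairing hμ (F := fun p : G × G => f (p.2 * p.1)) (by fun_prop))
  obtain ⟨m, h, C, _, hh, hC, hmC, rfl⟩ := exists_density hμ
  obtain ⟨n, k, D, _, hk, hD, hnD, rfl⟩ := exists_density hν
  have hF : Continuous fun p : G × G => f (p.1 * p.2) := by fun_prop
  have hint := integrable_continuous_mul_prod hC hD hmC hnD hh hk hF
  have hv := integrable_variation_withDensity (hh.mul_prod hk) hint hF
  have h1 : pairing f (conv (m.withDensityᵥ h) (n.withDensityᵥ k)) =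
      ∫ p, f (p.1 * p.2) * (h p.1 * k p.2) ∂m.prod n := by
    rw [conv, prod_withDensity hh hk, ← pairing_withDensity (hh.mul_prod hk) hv]
    exact VectorMeasure.integral_map measurable_mul hf.aestronglyMeasurable hv
  rw [h1]
  constructor
  · rw [pairing_withDensity hh hiν', integral_prod _ hint]
    refine integral_congr_ae (Filter.Eventually.of_forall fun x => ?_)
    simp only [pairing_withDensity hk (hiν x)]
    rw [← integral_mul_const]
    congr 1 with y
    ring
  · rw [pairing_withDensity hk hiμ', integral_prod_symm _ hint]
    refine integral_congr_ae (Filter.Eventually.of_forall fun y => ?_)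
    simp only [pairing_withDensity hh (hiμ y)]
    rw [← integral_mul_const]
    congr 1 with x
    ring

end Group

/-! ### Haar measures of `G` and `K` -/

section Group

variable {G : Type*} [Group G] [TopologicalSpace G] [IsTopologicalGroup G] [T2Space G]
  [SecondCountableTopology G] [MeasurableSpace G] [BorelSpace G]

/-- A Haar measure of a second countable unimodular group is invariant under inversion. -/
theorem isInvInvariant_of_isMulRightInvariant [LocallyCompactSpace G] (haar : Measure G)
    [haar.IsHaarMeasure] [haar.IsMulRightInvariant] : haar.IsInvInvariant := by
  constructor
  -- `haar.inv` is left invariant, hence equal to `c • haar`; inverting twice gives `c ^ 2 = 1`.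
  let c : ENNReal := Measure.haarScalarFactor haar.inv haar
  have hc : haar.inv = c • haar := Measure.isMulLeftInvariant_eq_smul haar.inv haar
  have h2 : haar = c ^ 2 • haar := by
    conv_lhs => rw [← haar.inv_inv, hc]
    rw [Measure.inv, Measure.map_smul, ← Measure.inv, hc, smul_smul, pow_two]
  have P : TopologicalSpace.PositiveCompacts G := Classical.arbitrary _
  have h3 : c ^ 2 * haar P = 1 ^ 2 * haar P := by
    conv_rhs => rw [h2]
    simp
  have h4 : c ^ 2 = 1 ^ 2 :=
    (ENNReal.mul_left_inj (Measure.measure_pos_of_nonempty_interior _ P.interior_nonempty).ne'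
      P.isCompact.measure_lt_top.ne).1 h3
  have h5 : c = 1 := (ENNReal.pow_right_strictMono two_ne_zero).injective h4
  rw [hc, h5, one_smul]

variable (K : Subgroup G) [CompactSpace K]

instance isHaarMeasure_haarK : (haarK K).IsHaarMeasure := by
  rw [haarK]; infer_instance

instance isProbabilityMeasure_haarK : IsProbabilityMeasure (haarK K) :=
  ⟨Measure.haarMeasure_self⟩

/-- Compact groups are unimodular. -/
instance isMulRightInvariant_haarK : (haarK K).IsMulRightInvariant := by
  refine ⟨fun k => ?_⟩
  have h := Measure.isMulInvariant_eq_smul_of_compactSpace ((haarK K).map (· * k)) (haarK K)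
  have h1 : ((haarK K).map (· * k)) Set.univ = 1 := by
    rw [Measure.map_apply (measurable_mul_const k) MeasurableSet.univ]
    simp
  rw [h, Measure.smul_apply, measure_univ] at h1
  rw [h]
  have : Measure.haarScalarFactor ((haarK K).map (· * k)) (haarK K) = 1 := by
    simpa [ENNReal.smul_def] using h1
  rw [this, one_smul]

theorem continuous_integral_haarK {Z : Type*} [TopologicalSpace Z] [FirstCountableTopology Z]
    [LocallyCompactSpace Z] {F : Z × K → ℂ} (hF : Continuous F) :
    Continuous fun z => ∫ k, F (z, k) ∂haarK K := by
  have := continuous_parametric_integral_of_continuous (μ := haarK K) (s := Set.univ)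
    (f := fun (z : Z) (k : K) => F (z, k)) (by
      simpa only [Function.uncurry_def] using hF) isCompact_univ
  simpa using this

/-! ### Biinvariant measures -/

/-- `μ` is invariant under left translations by `K`. -/
def IsLeftInvariant (K : Subgroup G) (μ : compactMeasures G) : Prop :=
  ∀ (f : C(G, ℂ)) (k : K), pairing (fun x => f (k * x)) μ.1 = pairing f μ.1

/-- `μ` is invariant under right translations by `K`. -/
def IsRightInvariant (K : Subgroup G) (μ : compactMeasures G) : Prop :=
  ∀ (f : C(G, ℂ)) (k : K), pairing (fun x => f (x * k)) μ.1 = pairing f μ.1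

variable [LocallyCompactSpace G]

theorem sharp_comp_mul_left (f : C(G, ℂ)) (k : K) :
    sharp K ⟨fun x => f (k * x), by fun_prop⟩ = sharp K f := by
  ext x
  refine integral_congr_ae (Filter.Eventually.of_forall fun k' => ?_)
  have := integral_mul_left_eq_self (μ := haarK K) (fun l : K => f (l * x * k')) k
  simpa [mul_assoc] using this

theorem sharp_comp_mul_right (f : C(G, ℂ)) (k : K) :
    sharp K ⟨fun x => f (x * k), by fun_prop⟩ = sharp K f := by
  ext x
  have := integral_mul_right_eq_self (μ := haarK K)
    (fun k' : K => ∫ l : K, f (l * x * k') ∂haarK K) k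
  simpa [sharp, mul_assoc] using this

theorem sharp_apply_mul_right (f : C(G, ℂ)) (x : G) (k : K) :
    sharp K f (x * k) = sharp K f x := by
  have := integral_mul_left_eq_self (μ := haarK K)
    (fun k' : K => ∫ l : K, f (l * x * k') ∂haarK K) k
  simpa [sharp, mul_assoc] using this

theorem sharp_apply_mul_left (f : C(G, ℂ)) (x : G) (k : K) :
    sharp K f (k * x) = sharp K f x := by
  refine integral_congr_ae (Filter.Eventually.of_forall fun k' => ?_)
  have := integral_mul_right_eq_self (μ := haarK K) (fun l : K => f (l * x * k')) k
  simpa [mul_assoc] using this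

theorem mem_biinvariant_iff {μ : compactMeasures G} :
    μ ∈ biinvariant K ↔ IsLeftInvariant K μ ∧ IsRightInvariant K μ := by
  have : SecondCountableTopology K := inferInstanceAs (SecondCountableTopology (K : Set G))
  constructor
  · intro h
    refine ⟨fun f k => ?_, fun f k => ?_⟩
    · rw [h f, ← sharp_comp_mul_left K f k]
      exact h ⟨fun x => f (k * x), by fun_prop⟩
    · rw [h f, ← sharp_comp_mul_right K f k]
      exact h ⟨fun x => f (x * k), by fun_prop⟩
  · rintro ⟨hl, hr⟩ f
    have h1 : Continuous fun p : K × G => ∫ l : K, f (l * p.2 * p.1) ∂haarK K :=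
      continuous_integral_haarK K (F := fun p : (K × G) × K => f (p.2 * p.1.2 * p.1.1))
        (by fun_prop)
    have h2 : pairing (sharp K f) μ.1 =
        ∫ k : K, pairing (fun x => ∫ l : K, f (l * x * k) ∂haarK K) μ.1 ∂haarK K :=
      (integral_pairing μ.2 h1 (sharp K f).continuous).symm
    have h3 : ∀ k : K, pairing (fun x => ∫ l : K, f (l * x * k) ∂haarK K) μ.1 = pairing f μ.1 := by
      intro k
      rw [← integral_pairing μ.2 (F := fun p : K × G => f (p.1 * p.2 * k)) (by fun_prop)
        (h1.comp (Continuous.prodMk_right k))]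
      have h4 : ∀ l : K, pairing (fun x => f (l * x * k)) μ.1 = pairing f μ.1 := fun l =>
        (hl ⟨fun x => f (x * k), by fun_prop⟩ l).trans (hr f k)
      simp [h4]
    simp [h2, h3]

theorem IsLeftInvariant.mul {μ : compactMeasures G} (hμ : IsLeftInvariant K μ)
    (ν : compactMeasures G) : IsLeftInvariant K (μ * ν) := by
  intro f k
  refine (pairing_conv μ.2 ν.2 (by fun_prop)).1.trans ?_
  refine Eq.trans ?_ (pairing_conv μ.2 ν.2 f.continuous).1.symm
  simp only [← mul_assoc]
  exact hμ ⟨fun x => pairing (fun y => f (x * y)) ν.1,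
    continuous_pairing ν.2 (F := fun p : G × G => f (p.1 * p.2)) (by fun_prop)⟩ k

theorem IsRightInvariant.mul (μ : compactMeasures G) {ν : compactMeasures G}
    (hν : IsRightInvariant K ν) : IsRightInvariant K (μ * ν) := by
  intro f k
  refine (pairing_conv μ.2 ν.2 (by fun_prop)).2.trans ?_
  refine Eq.trans ?_ (pairing_conv μ.2 ν.2 f.continuous).2.symm
  simp only [mul_assoc]
  exact hν ⟨fun y => pairing (fun x => f (x * y)) μ.1,
    continuous_pairing μ.2 (F := fun p : G × G => f (p.2 * p.1)) (by fun_prop)⟩ k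

theorem mul_mem_biinvariant {μ ν : compactMeasures G} (hμ : IsLeftInvariant K μ)
    (hν : IsRightInvariant K ν) : μ * ν ∈ biinvariant K :=
  (mem_biinvariant_iff K).2 ⟨hμ.mul K ν, hν.mul K μ⟩

/-! ### The generators of the ideal -/

theorem pairing_cosetMeasure {f : G → ℂ} (hf : Continuous f) (g : G) :
    pairing f (cosetMeasure K g).1 = ∫ k : K, f (g * k) ∂haarK K := by
  have hfg : Continuous fun k : K => f (g * k) := by fun_prop
  have h1 : Integrable (fun _ : K => (1 : ℂ)) (haarK K) := integrable_const _
  have hi := integrable_continuous_mul isCompact_univ (by simp) h1 hfg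
  have hv := integrable_variation_withDensity h1 hi hfg
  have h := pairing_withDensity h1 hv
  simp only [mul_one] at h
  rw [← h]
  exact VectorMeasure.integral_map (by fun_prop) hf.aestronglyMeasurable hv

theorem isRightInvariant_cosetMeasure (g : G) : IsRightInvariant K (cosetMeasure K g) := by
  intro f k
  rw [pairing_cosetMeasure K (by fun_prop), pairing_cosetMeasure K f.continuous]
  have := integral_mul_right_eq_self (μ := haarK K) (fun l : K => f (g * l)) k
  simpa [mul_assoc] using this

theorem isLeftInvariant_cosetMeasure_one : IsLeftInvariant K (cosetMeasure K 1) := by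
  intro f k
  rw [pairing_cosetMeasure K (by fun_prop), pairing_cosetMeasure K f.continuous]
  have := integral_mul_left_eq_self (μ := haarK K) (fun l : K => f l) k
  simpa using this

variable (haar : Measure G) [haar.IsHaarMeasure] {E : Set (G ⧸ K)}

theorem isClosed_lift (hE : IsCompact E) : IsClosed (lift K E) := by
  have : IsClosed (K : Set G) := (isCompact_iff_compactSpace.2 ‹_›).isClosed
  exact hE.isClosed.preimage QuotientGroup.continuous_mk

theorem integrable_checkChar (hE : IsCompact E) : Integrable (checkChar K E) haar := by
  obtain ⟨C, hC, hEC⟩ := exists_compact_of_lift K hE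
  have hm : MeasurableSet (lift K E)⁻¹ := (isClosed_lift K hE).inv.measurableSet
  have : checkChar K E = (lift K E)⁻¹.indicator fun _ => 1 := rfl
  rw [this, integrable_indicator_iff hm]
  exact integrableOn_const ((measure_mono hEC).trans_lt hC.measure_lt_top).ne

theorem checkChar_mul_left (E : Set (G ⧸ K)) (k : K) (x : G) :
    checkChar K E (k * x) = checkChar K E x := by
  have h : (((k * x)⁻¹ : G) : G ⧸ K) = ((x⁻¹ : G) : G ⧸ K) := by
    rw [QuotientGroup.eq]
    simp
  have h' : (k * x : G)⁻¹ ∈ lift K E ↔ x⁻¹ ∈ lift K E := iff_of_eq (congrArg (· ∈ E) h)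
  by_cases hx : x⁻¹ ∈ lift K E
  · simp only [checkChar, Set.indicator_of_mem hx, Set.indicator_of_mem (h'.2 hx)]
  · simp only [checkChar, Set.indicator_of_notMem hx, Set.indicator_of_notMem (mt h'.1 hx)]

variable (hE : IsCompact E)

theorem pairing_checkMeasure {f : G → ℂ} (hf : Continuous f) :
    pairing f (checkMeasure K haar E hE).1 = ∫ x, f x * checkChar K E x ∂haar :=
  pairing_withDensity (integrable_checkChar K haar hE)
    (integrable_of_mem (checkMeasure K haar E hE).2 hf)

theorem isLeftInvariant_checkMeasure : IsLeftInvariant K (checkMeasure K haar E hE) := by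
  intro f k
  rw [pairing_checkMeasure K haar hE (by fun_prop), pairing_checkMeasure K haar hE f.continuous,
    ← integral_mul_left_eq_self (μ := haar) (fun x => f x * checkChar K E x) k]
  simp only [checkChar_mul_left]

/-- The integral over `gE` of a continuous function `F` on `G/K` as a pairing with the measure
`checkMeasure`, by the substitution `x ↦ (x g⁻¹)⁻¹`. -/
theorem setIntegral_smul_eq_pairing [haar.IsMulRightInvariant] {F : G ⧸ K → ℂ}
    (hF : Continuous F) (g : G) :
    ∫ q in g • E, F q ∂quotientMeasure K haar =
      pairing (fun x => F ((g * x⁻¹ : G) : G ⧸ K)) (checkMeasure K haar E hE).1 := by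
  have := isInvInvariant_of_isMulRightInvariant haar
  have hmk : Continuous ((↑) : G → G ⧸ K) := QuotientGroup.continuous_mk
  have hmem : ∀ x : G, (x : G ⧸ K) ∈ g • E ↔ g⁻¹ * x ∈ lift K E := fun x => by
    rw [Set.mem_smul_set_iff_inv_smul_mem]; rfl
  have hcl : IsClosed (((↑) : G → G ⧸ K) ⁻¹' (g • E)) := by
    convert (isClosed_lift K hE).preimage (continuous_const_mul g⁻¹) using 1
    ext x
    exact hmem x
  have hms : MeasurableSet (g • E) := hcl.measurableSet
  have hFm : Measurable F := QuotientGroup.measurable_from_quotient.2 (hF.comp hmk).measurable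
  rw [quotientMeasure, setIntegral_map hms hFm.aestronglyMeasurable
    QuotientGroup.measurable_coe.aemeasurable, pairing_checkMeasure K haar hE (by fun_prop),
    ← integral_indicator hcl.measurableSet, ← integral_inv_eq_self _ haar,
    ← integral_mul_right_eq_self _ g⁻¹]
  congr 1 with x
  have h1 : (x * g⁻¹)⁻¹ = g * x⁻¹ := by group
  rw [h1]
  by_cases hx : x⁻¹ ∈ lift K E
  · have : ((g * x⁻¹ : G) : G ⧸ K) ∈ g • E := (hmem _).2 (by simpa using hx)
    simp [Set.indicator, checkChar, hx, this]
  · have : ((g * x⁻¹ : G) : G ⧸ K) ∉ g • E := fun h => hx (by simpa using (hmem _).1 h)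
    simp [Set.indicator, checkChar, hx, this]

theorem checkMeasure_mul_cosetMeasure_mem (g : G) :
    checkMeasure K haar E hE * cosetMeasure K g ∈ biinvariant K :=
  mul_mem_biinvariant K (isLeftInvariant_checkMeasure K haar hE)
    (isRightInvariant_cosetMeasure K g)

end Group

/-! ### Weak*-continuous functionals -/

section Group

variable {G : Type*} [Group G] [TopologicalSpace G] [IsTopologicalGroup G] [T2Space G]
  [SecondCountableTopology G] [MeasurableSpace G] [BorelSpace G]

theorem pairing_sum {ι : Type*} [Fintype ι] (c : ι → ℂ) (f : ι → C(G, ℂ))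
    (μ : compactMeasures G) :
    pairing (∑ i, c i • f i : C(G, ℂ)) μ.1 = ∑ i, c i * pairing (f i) μ.1 := by
  have h1 := integrable_of_mem μ.2 (∑ i, c i • f i : C(G, ℂ)).continuous
  have h2 := fun i => integrable_of_mem μ.2 (f i).continuous
  obtain ⟨m, h, C, _, hh, hC, hmC, hμ⟩ := exists_density μ.2
  rw [hμ] at h1 h2 ⊢
  rw [pairing_withDensity hh h1]
  simp only [fun i => pairing_withDensity hh (h2 i), ← integral_const_mul]
  rw [← integral_finsetSum _ fun i _ =>
    (integrable_continuous_mul hC hmC hh (f i).continuous).const_mul _]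
  congr 1 with x
  simp [Finset.sum_mul, mul_assoc]

/-- The pairing with a fixed continuous function, as a linear functional on `M_c(G)`. -/
def pairingLinear (f : C(G, ℂ)) : compactMeasures G →ₗ[ℂ] ℂ where
  toFun μ := pairing f μ.1
  map_add' μ ν := pairing_add (integrable_of_mem μ.2 f.continuous)
    (integrable_of_mem ν.2 f.continuous)
  map_smul' c μ := pairing_smul (integrable_of_mem μ.2 f.continuous) c

theorem continuous_pairingLinear (f : C(G, ℂ)) : Continuous (pairingLinear f) :=
  (continuous_apply f).comp (continuous_induced_dom (f := fun (μ : compactMeasures G)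
    (f : C(G, ℂ)) => pairing f μ.1))

/-- The Hahn-Banach theorem for the weak* topology. A basic neighbourhood involves only finitely
many continuous functions, so that the statement reduces to linear algebra in finite dimension. -/
theorem exists_pairing_ne_zero {M J : Submodule ℂ (compactMeasures G)}
    (hJ : IsClosed {μ : M | (μ : compactMeasures G) ∈ J}) {μ₀ : compactMeasures G}
    (hM : μ₀ ∈ M) (h₀ : μ₀ ∉ J) (hJM : J ≤ M) :
    ∃ f : C(G, ℂ), (∀ μ ∈ J, pairing f μ.1 = 0) ∧ pairing f μ₀.1 ≠ 0 := by
  classical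
  have hn : {μ : M | (μ : compactMeasures G) ∈ J}ᶜ ∈ 𝓝 (⟨μ₀, hM⟩ : M) :=
    hJ.isOpen_compl.mem_nhds h₀
  rw [nhds_subtype, Filter.mem_comap] at hn
  obtain ⟨V, hV, hVJ⟩ := hn
  rw [nhds_induced, Filter.mem_comap] at hV
  obtain ⟨W, hW, hWV⟩ := hV
  rw [nhds_pi, Filter.mem_pi'] at hW
  obtain ⟨I, t, ht, htW⟩ := hW
  let Φ : compactMeasures G →ₗ[ℂ] (I → ℂ) := LinearMap.pi fun f => pairingLinear f.1
  -- An element of `J` with the same image as `μ₀` would lie in the neighbourhood of `μ₀` that `I`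
  -- and `t` define, which misses `J`.
  have hΦ : Φ μ₀ ∉ J.map Φ := by
    rintro ⟨μ, hμ, hμΦ⟩
    refine hVJ (show (⟨μ, hJM hμ⟩ : M) ∈ _ from hWV (htW fun f hf => ?_)) hμ
    have h1 : pairing f μ.1 = pairing f μ₀.1 := congrFun hμΦ ⟨f, hf⟩
    change pairing f μ.1 ∈ t f
    rw [h1]
    exact mem_of_mem_nhds (ht f)
  obtain ⟨ψ, hψ, hψJ⟩ := Submodule.exists_dual_map_eq_bot_of_notMem hΦ inferInstance
  have key : ∀ μ : compactMeasures G,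
      pairing (∑ i : I, ψ (Pi.single i 1) • i.1 : C(G, ℂ)) μ.1 = ψ (Φ μ) := by
    intro μ
    rw [pairing_sum, LinearMap.pi_apply_eq_sum_univ ψ (Φ μ)]
    refine Finset.sum_congr rfl fun i _ => ?_
    rw [smul_eq_mul, mul_comm]
    congr 2
    ext j
    simp [Pi.single_apply, eq_comm]
  refine ⟨_, fun μ hμ => ?_, by rwa [key]⟩
  rw [key, ← Submodule.mem_bot ℂ, ← hψJ]
  exact Submodule.mem_map_of_mem (Submodule.mem_map_of_mem hμ)

/-! ### Closed right ideals -/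

variable [LocallyCompactSpace G] (K : Subgroup G) [CompactSpace K]

theorem isClosedRightIdeal_biinvariant : IsClosedRightIdeal K (biinvariant K) where
  le_biinvariant := le_rfl
  mul_mem μ hμ ν hν := mul_mem_biinvariant K ((mem_biinvariant_iff K).1 hμ).1
    ((mem_biinvariant_iff K).1 hν).2
  isClosed := by simp

/-- The biinvariant measures that annihilate all right translates of `h`. -/
def annihilator (h : C(G, ℂ)) : Submodule ℂ (compactMeasures G) :=
  biinvariant K ⊓ ⨅ z : G, LinearMap.ker (pairingLinear ⟨fun x => h (x * z), by fun_prop⟩)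

theorem mem_annihilator {h : C(G, ℂ)} {μ : compactMeasures G} :
    μ ∈ annihilator K h ↔ μ ∈ biinvariant K ∧ ∀ z, pairing (fun x => h (x * z)) μ.1 = 0 := by
  simp [annihilator, pairingLinear]

/-- Closedness under right multiplication: with `ν` integrated last, `⟨h(· z), μ * ν⟩` is the
integral over `y` of `⟨h(· yz), μ⟩ = 0`. -/
theorem isClosedRightIdeal_annihilator (h : C(G, ℂ)) :
    IsClosedRightIdeal K (annihilator K h) where
  le_biinvariant := inf_le_left
  mul_mem μ hμ ν hν := by
    rw [mem_annihilator] at hμ ⊢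
    refine ⟨(isClosedRightIdeal_biinvariant K).mul_mem μ hμ.1 ν hν, fun z => ?_⟩
    refine (pairing_conv μ.2 ν.2 (by fun_prop)).2.trans ?_
    simp only [mul_assoc, hμ.2]
    exact VectorMeasure.integral_zero
  isClosed := by
    have : {μ : biinvariant K | (μ : compactMeasures G) ∈ annihilator K h} =
        ⋂ z : G, {μ : biinvariant K |
          pairingLinear ⟨fun x => h (x * z), by fun_prop⟩ (μ : compactMeasures G) = 0} := by
      ext μ
      simp [mem_annihilator, pairingLinear]
    rw [this]
    exact isClosed_iInter fun z => isClosed_eq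
      ((continuous_pairingLinear _).comp continuous_subtype_val) continuous_const

variable (haar : Measure G) [haar.IsHaarMeasure] {E : Set (G ⧸ K)} (hE : IsCompact E)

theorem pairing_checkMeasure_mul_cosetMeasure {f : G → ℂ} (hf : Continuous f) (g : G) :
    pairing f (checkMeasure K haar E hE * cosetMeasure K g).1 =
      ∫ k : K, pairing (fun x => f (x * (g * k))) (checkMeasure K haar E hE).1 ∂haarK K := by
  refine (pairing_conv (checkMeasure K haar E hE).2 (cosetMeasure K g).2 hf).2.trans ?_
  exact pairing_cosetMeasure K (continuous_pairing (checkMeasure K haar E hE).2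
    (F := fun p : G × G => f (p.2 * p.1)) (by fun_prop)) g

variable [haar.IsMulRightInvariant]

/-! ### The Pompeiu property and the generated ideal -/

theorem hasPompeiuProperty_of_closedRightIdealSpan_eq {T : Set G}
    (h : closedRightIdealSpan K
        {μ | ∃ g ∈ T, μ = checkMeasure K haar E hE * cosetMeasure K g} = biinvariant K) :
    HasPompeiuProperty K haar E := by
  intro f hf
  let φ : C(G, ℂ) := ⟨fun x => f ((x⁻¹ : G) : G ⧸ K), by
    have : Continuous ((↑) : G → G ⧸ K) := QuotientGroup.continuous_mk
    fun_prop⟩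
  have hφ : ∀ z, pairing (fun x => φ (x * z)) (checkMeasure K haar E hE).1 = 0 := by
    intro z
    rw [← hf z⁻¹, setIntegral_smul_eq_pairing K haar hE f.continuous]
    simp [φ]
  have hle : biinvariant K ≤ annihilator K φ := by
    rw [← h]
    refine sInf_le ⟨isClosedRightIdeal_annihilator K φ, ?_⟩
    rintro _ ⟨g, -, rfl⟩
    refine (mem_annihilator K).2 ⟨checkMeasure_mul_cosetMeasure_mem K haar hE g, fun z => ?_⟩
    rw [pairing_checkMeasure_mul_cosetMeasure K haar hE (by fun_prop)]
    simp only [mul_assoc]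
    simp only [hφ, integral_zero]
  have h1 : cosetMeasure K 1 ∈ annihilator K φ := hle ((mem_biinvariant_iff K).2
    ⟨isLeftInvariant_cosetMeasure_one K, isRightInvariant_cosetMeasure K 1⟩)
  ext q
  obtain ⟨x, rfl⟩ := QuotientGroup.mk_surjective q
  -- `φ` is left `K`-invariant, so pairing its translate with the Haar measure of `K` evaluates it.
  have h2 := ((mem_annihilator K).1 h1).2 x⁻¹
  rw [pairing_cosetMeasure K (by fun_prop)] at h2
  have h3 : ∀ k : K, φ (k * x⁻¹) = f x := by
    intro k
    refine congrArg f ?_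
    rw [QuotientGroup.eq]
    simp
  simpa [h3] using h2

theorem closedRightIdealSpan_eq_of_hasPompeiuProperty {T : Set G}
    (hT : Subgroup.IsComplement T (K : Set G)) (h : HasPompeiuProperty K haar E) :
    closedRightIdealSpan K
        {μ | ∃ g ∈ T, μ = checkMeasure K haar E hE * cosetMeasure K g} = biinvariant K := by
  refine le_antisymm (sInf_le ⟨isClosedRightIdeal_biinvariant K, ?_⟩) (le_sInf ?_)
  · rintro _ ⟨g, -, rfl⟩
    exact checkMeasure_mul_cosetMeasure_mem K haar hE g
  rintro J ⟨hJ, hS⟩ μ₀ hμ₀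
  by_contra hμ₀J
  obtain ⟨f, hfJ, hf⟩ := exists_pairing_ne_zero hJ.isClosed hμ₀ hμ₀J hJ.le_biinvariant
  rw [hμ₀ f] at hf
  refine hf ?_
  have hcheck : ∀ g : G,
      pairing (fun x => sharp K f (x * g)) (checkMeasure K haar E hE).1 = 0 := by
    intro g
    obtain ⟨⟨t, k⟩, rfl⟩ := hT.2 g
    have ht := hfJ _ (hS ⟨t, t.2, rfl⟩)
    rw [checkMeasure_mul_cosetMeasure_mem K haar hE t f,
      pairing_checkMeasure_mul_cosetMeasure K haar hE (sharp K f).continuous] at ht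
    have hk : ∀ (x : G) (k : K), sharp K f (x * (t * k)) = sharp K f (x * t) := fun x k => by
      rw [← mul_assoc, sharp_apply_mul_right]
    have hk' : ∀ x : G, sharp K f (x * (t * k)) = sharp K f (x * t) := fun x => hk x ⟨k, k.2⟩
    simpa [hk, hk'] using ht
  -- `x ↦ f^#(x⁻¹)` descends to `G/K`, since `f^#` is left `K`-invariant.
  let F : C(G ⧸ K, ℂ) := ⟨Quotient.lift (fun x => sharp K f x⁻¹) (by
      intro x y hxy
      obtain ⟨k, hk⟩ : ∃ k : K, y = x * k :=
        ⟨⟨x⁻¹ * y, QuotientGroup.leftRel_apply.1 hxy⟩, by simp⟩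
      rw [hk, mul_inv_rev]
      exact (sharp_apply_mul_left K f x⁻¹ k⁻¹).symm),
    Continuous.quotient_lift (by fun_prop) _⟩
  have hF : F = 0 := by
    refine h F fun g => ?_
    rw [setIntegral_smul_eq_pairing K haar hE F.continuous, ← hcheck g⁻¹]
    congr 1 with x
    change sharp K f (g * x⁻¹)⁻¹ = _
    simp
  have h0 : (sharp K f : G → ℂ) = fun _ => 0 := by
    ext x
    have := congrArg (fun F : C(G ⧸ K, ℂ) => F ((x⁻¹ : G) : G ⧸ K)) hF
    change sharp K f (x⁻¹)⁻¹ = 0 at this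
    simpa using this
  rw [h0]
  exact VectorMeasure.integral_zero

end Group
end Pompeiu

end

theorem mainTheorem2 {G : Type*} [Group G] [TopologicalSpace G] [IsTopologicalGroup G]
    [T2Space G] [LocallyCompactSpace G] [SecondCountableTopology G]
    [MeasurableSpace G] [BorelSpace G]
    (haar : MeasureTheory.Measure G) [haar.IsHaarMeasure] [haar.IsMulRightInvariant]
    (K : Subgroup G) [CompactSpace K]
    (T : Set G) (hT : Subgroup.IsComplement T (K : Set G))
    (E : Set (G ⧸ K)) (hE : IsCompact E) :
    Pompeiu.HasPompeiuProperty K haar E ↔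
      Pompeiu.closedRightIdealSpan K
        {μ | ∃ g ∈ T, μ = Pompeiu.checkMeasure K haar E hE * Pompeiu.cosetMeasure K g} =
      Pompeiu.biinvariant K :=
  ⟨Pompeiu.closedRightIdealSpan_eq_of_hasPompeiuProperty K haar hE hT,
    Pompeiu.hasPompeiuProperty_of_closedRightIdealSpan_eq K haar hE⟩
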